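/- Let $\mathbb{O}=\mathbb{H}\oplus\mathbb{H}$ be the octonions, with product $(a,b)(c,d)=(ac-\bar d\,b,\;da+b\bar c)$ and conjugation $\overline{(a,b)}=(\bar a,-b)$, and let $B^2=\{x\in\mathbb{O}^2: |x|<1\}$ be the open unit ball, where $|x|^2=|x_1|^2+|x_2|^2$. An octonionic (right) line is a real subspace of $\mathbb{O}^2$ of the form $\{(t,\alpha t):t\in\mathbb{O}\}$ with $\alpha\in\mathbb{O}$, or $\{(0,t):t\in\mathbb{O}\}$; affine octonionic lines are the translates of these. A function $u:\Omega\to[-\infty,+\infty)$ on an open set $\Omega\subset\mathbb{O}^2$ is octonionic plurisubharmonic (OPSH) if it is upper semicontinuous and its restriction to (the part in $\Omega$ of) every affine octonionic line is subharmonic; the function $-\infty$ counts as subharmonic. Let $\mathcal U=\{y\in\mathbb{O}^2: 2\operatorname{Re}y_2-|y_1|^2>0\}$ and define $$C:B^2\to\mathcal U,\quad C(x)=\big(\sqrt2\,x_1(1+x_2)^{-1},\ (1-x_2)(1+x_2)^{-1}\big),$$ whose inverse $C^{-1}:\mathcal U\to B^2$ is given by the same expression $C^{-1}(y)=\big(\sqrt2\,y_1(1+y_2)^{-1},\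 (1-y_2)(1+y_2)^{-1}\big)$. For $\zeta\in\partial\mathcal U$ and $\delta>0$ put $$\tau_\zeta(x)=\big(x_1+\zeta_1,\ x_2+\zeta_2+\bar\zeta_1x_1\big),\qquad D_\delta(x)=(\delta x_1,\delta^2x_2).$$ For $a\in B^2$ let $$\delta_a=\frac{|1+a_2|}{(1-|a|^2)^{1/2}},\qquad \zeta_a=\Big(-[C(a)]_1,\ \tfrac12\big|[C(a)]_1\big|^2-\operatorname{Im}[C(a)]_2\Big)\in\partial\mathcal U,$$ $$T_a=C^{-1}\circ D_{\delta_a}\circ\tau_{\zeta_a}\circ C,\qquad \Psi_a(x)=2\,(1+[T_a(x)]_2)^{-1}(1+x_2).$$ Then for every $a\in B^2$: 1. $T_a$ is a $C^\infty$ diffeomorphism of $B^2$ onto itself, and $T_a(a)=0$; 2. $\Psi_a(x)\neq0$ for every $x\in B^2$, and for every OPSH function $u$ on $B^2$ the function $$(T_a^*u)(x)=\frac{1}{|\Psi_a(x)|^6}\,u(T_a(x))$$ is also OPSH on $B^2$. -/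

import Mathlib

open scoped ContDiff

noncomputable section

/-! Octonions as pairs of real quaternions, with the Euclidean norm and inner product of `ℝ⁸`. -/

/-- The octonions `𝕆`: pairs `(a, b)` of quaternions, standing for `a + b e₅`. As a real inner
product space this is the orthogonal sum `ℍ ⊕ ℍ ≅ ℝ⁸`, so `‖x‖` is the octonionic modulus. -/
abbrev Octonion : Type := WithLp 2 (Quaternion ℝ × Quaternion ℝ)

/-- The space `𝕆²` with the Euclidean norm `‖x‖² = ‖x₁‖² + ‖x₂‖²` of `ℝ¹⁶`. -/
abbrev OctonionPlane : Type := WithLp 2 (Octonion × Octonion)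

namespace Octonion

/-- Octonion multiplication `(a, b)(c, d) = (a c - d̄ b, d a + b c̄)`. -/
instance : Mul Octonion where
  mul x y := WithLp.toLp 2
    (x.fst * y.fst - star y.snd * x.snd, y.snd * x.fst + x.snd * star y.fst)

instance : One Octonion where
  one := WithLp.toLp 2 (1, 0)

/-- Octonion conjugation `(a, b) ↦ (ā, -b)`. -/
def conj (x : Octonion) : Octonion := WithLp.toLp 2 (star x.fst, -x.snd)

/-- The inverse `x⁻¹ = x̄ / |x|²` of a nonzero octonion. -/
instance : Inv Octonion where
  inv x := (‖x‖ ^ 2)⁻¹ • conj x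

/-- The real part of an octonion. -/
def re (x : Octonion) : ℝ := x.fst.re

/-- The imaginary part `x - Re x` of an octonion. -/
def im (x : Octonion) : Octonion := x - re x • (1 : Octonion)

/-- The point `(x₁, x₂)` of `𝕆²`. -/
def pt (x₁ x₂ : Octonion) : OctonionPlane := WithLp.toLp 2 (x₁, x₂)

/-- The open unit ball `B²` of `𝕆²`. -/
def unitBall : Set OctonionPlane := Metric.ball 0 1

/-- A function with values in `[-∞, +∞)` is subharmonic on `Ω` if it is upper semicontinuous on `Ω`
and, on every relatively compact open `G` in `Ω`, it lies below every function that is continuous on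
the closure of `G`, harmonic in `G`, and above it on the boundary of `G`. The function that is
identically `-∞` is allowed. -/
def SubharmonicOn {E : Type*} [NormedAddCommGroup E] [InnerProductSpace ℝ E]
    [FiniteDimensional ℝ E] (f : E → EReal) (Ω : Set E) : Prop :=
  UpperSemicontinuousOn f Ω ∧ (∀ x ∈ Ω, f x < ⊤) ∧
    ∀ (G : Set E) (h : E → ℝ), IsOpen G → IsCompact (closure G) → closure G ⊆ Ω →
      InnerProductSpace.HarmonicContOnCl h G →
      (∀ x ∈ frontier G, f x ≤ (h x : EReal)) → ∀ x ∈ G, f x ≤ (h x : EReal)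

/-- Octonionic plurisubharmonic functions on `Ω ⊆ 𝕆²`: upper semicontinuous with values in
`[-∞, +∞)`, and subharmonic on (the part in `Ω` of) every affine octonionic right line, that is,
every translate of `{(t, α t)}`, `α ∈ 𝕆`, or of `{(0, t)}`. The parametrizations `t ↦ p + (t, α t)`
and `t ↦ p + (0, t)` of such a line by `𝕆 = ℝ⁸` are similarities, so subharmonicity on the line is
subharmonicity in the parameter `t`. -/
def OPSH (Ω : Set OctonionPlane) (u : OctonionPlane → EReal) : Prop :=
  UpperSemicontinuousOn u Ω ∧ (∀ x ∈ Ω, u x < ⊤) ∧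
    ∀ p : OctonionPlane,
      (∀ α : Octonion,
        SubharmonicOn (fun t : Octonion => u (p + pt t (α * t))) {t | p + pt t (α * t) ∈ Ω}) ∧
      SubharmonicOn (fun t : Octonion => u (p + pt 0 t)) {t | p + pt 0 t ∈ Ω}

/-- The Cayley transform `C(x) = (√2 x₁ (1 + x₂)⁻¹, (1 - x₂)(1 + x₂)⁻¹)` from the unit ball to the
Siegel upper half space `{y | 2 Re y₂ - |y₁|² > 0}`. -/
def cayley (x : OctonionPlane) : OctonionPlane :=
  pt (√2 • (x.fst * (1 + x.snd)⁻¹)) ((1 - x.snd) * (1 + x.snd)⁻¹)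

/-- The inverse Cayley transform
`C⁻¹(y) = (√2 y₁ (1 + y₂)⁻¹, (1 - y₂)(1 + y₂)⁻¹)` from the Siegel upper half space to the unit
ball. It is given by the same expression as `C`. -/
def cayleyInv (y : OctonionPlane) : OctonionPlane :=
  pt (√2 • (y.fst * (1 + y.snd)⁻¹)) ((1 - y.snd) * (1 + y.snd)⁻¹)

/-- The Heisenberg left translation `τ_ζ(x) = (x₁ + ζ₁, x₂ + ζ₂ + ζ̄₁ x₁)`. -/
def heisenbergTranslate (ζ x : OctonionPlane) : OctonionPlane :=
  pt (x.fst + ζ.fst) (x.snd + ζ.snd + conj ζ.fst * x.fst)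

/-- The dilation `D_δ(x) = (δ x₁, δ² x₂)`. -/
def dilate (δ : ℝ) (x : OctonionPlane) : OctonionPlane :=
  pt (δ • x.fst) (δ ^ 2 • x.snd)

/-- `δ_a = |1 + a₂| / (1 - |a|²)^{1/2}`. -/
def delta (a : OctonionPlane) : ℝ := ‖1 + a.snd‖ / √(1 - ‖a‖ ^ 2)

/-- `ζ_a = (-[C(a)]₁, ½ |[C(a)]₁|² - Im [C(a)]₂)`, a point of the boundary
`2 Re ζ₂ = |ζ₁|²` of the Siegel upper half space. -/
def zeta (a : OctonionPlane) : OctonionPlane :=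
  pt (-(cayley a).fst)
    ((1 / 2 * ‖(cayley a).fst‖ ^ 2 : ℝ) • (1 : Octonion) - im (cayley a).snd)

/-- The ball automorphism `T_a = C⁻¹ ∘ D_{δ_a} ∘ τ_{ζ_a} ∘ C`. -/
def ballAut (a x : OctonionPlane) : OctonionPlane :=
  cayleyInv (dilate (delta a) (heisenbergTranslate (zeta a) (cayley x)))

/-- `Ψ_a(x) = 2 (1 + [T_a(x)]₂)⁻¹ (1 + x₂)`. -/
def psi (a x : OctonionPlane) : Octonion :=
  (2 : ℝ) • ((1 + (ballAut a x).snd)⁻¹ * (1 + x.snd))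

/-- The weighted pullback `(T_a^* u)(x) = |Ψ_a(x)|⁻⁶ u(T_a(x))`. -/
def weightedPullback (a : OctonionPlane) (u : OctonionPlane → EReal) (x : OctonionPlane) : EReal :=
  ((1 / ‖psi a x‖ ^ 6 : ℝ) : EReal) * u (ballAut a x)

end Octonion

end

/-! The inverse Cayley transform is given by the same formula as `cayley`, so T_a is `cayley`, then
an affine map of the Siegel half space, then `cayley` again. The proof follows a plurisubharmonic
function through these three maps.

The affine map x ↦ D_δ(τ_ζ(x)) carries right lines to right lines, and does so by similarities of
the parameter, so it preserves OPSH without any weight.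

The Cayley transform also carries right lines into right lines. On the line t ↦ p + (t, αt) with α ≠
0, the quantity r = 1 + x₂ is a similarity of t, and C(x) = const + (κ r⁻¹, 2 r⁻¹) with κ constant
on the line. Thus C restricted to the line is an inversion of ℝ⁸ composed with similarities. In
dimension eight the Kelvin transform f ↦ |r|⁻⁶ f(r⁻¹) preserves harmonicity, hence subharmonicity,
so u ↦ |1 + x₂|⁻⁶ u(C(x)) preserves OPSH (`OPSH.cayley`). This is the origin of the exponent 6.

Two Cayley transforms produce the product of two such weights, and `norm_psi` identifies it with
|Ψ_a(x)|⁻⁶. No associativity is needed: the octonion algebra used is bilinearity, |xy| = |x||y|, and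
the identities x̄(xy) = |x|²y and (yx)x̄ = |x|²y. -/

noncomputable section

/-! ### Harmonic functions under similarities and the Kelvin transform in dimension eight. -/

section Harmonic

open InnerProductSpace Filter Topology
open scoped Laplacian RealInnerProductSpace

variable {E : Type*} [NormedAddCommGroup E] [InnerProductSpace ℝ E]

/-- Reduces a pure second derivative to a one-variable derivative along a line, once a formula for
the first derivative is known near the point. This is how the Laplacian of the Kelvin transform is
computed. -/
theorem iteratedFDeriv_two_apply_eq_of_hasDerivAt {f : E → ℝ} {x v : E} {F : E → ℝ} {d : ℝ}
    (hf : ContDiffAt ℝ 2 f x) (hF : ∀ᶠ y in 𝓝 x, fderiv ℝ f y v = F y)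
    (hd : HasDerivAt (fun t : ℝ => F (x + t • v)) d 0) :
    iteratedFDeriv ℝ 2 f x ![v, v] = d := by
  rw [iteratedFDeriv_two_apply]
  simp only [Matrix.cons_val_zero, Matrix.cons_val_one]
  have hp : HasDerivAt (fun t : ℝ => x + t • v) v 0 := by
    simpa using ((hasDerivAt_id (0 : ℝ)).smul_const v).const_add x
  have h1 : HasFDerivAt (fderiv ℝ f) (fderiv ℝ (fderiv ℝ f) x) (x + (0 : ℝ) • v) := by
    simpa using ((hf.fderiv_right (m := 1) (by norm_num)).differentiableAt
      (by norm_num)).hasFDerivAt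
  have h2 : HasDerivAt (fun t : ℝ => fderiv ℝ f (x + t • v) v)
      (fderiv ℝ (fderiv ℝ f) x v v) 0 := by
    have h3 := h1.comp_hasDerivAt (0 : ℝ) hp
    exact (ContinuousLinearMap.apply ℝ ℝ v).hasFDerivAt.comp_hasDerivAt (0 : ℝ) h3
  refine h2.unique (hd.congr_of_eventuallyEq ?_)
  have hc : Tendsto (fun t : ℝ => x + t • v) (𝓝 0) (𝓝 x) := by
    simpa using hp.continuousAt.tendsto
  exact hc.eventually hF

theorem hasDerivAt_inversion_line {x v : E} (hx : x ≠ 0) :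
    HasDerivAt (fun t : ℝ => (‖x + t • v‖ ^ 2)⁻¹ • (x + t • v))
      ((‖x‖ ^ 2)⁻¹ • v - (2 * ⟪x, v⟫ * ((‖x‖ ^ 2)⁻¹) ^ 2) • x) 0 := by
  have hp : HasDerivAt (fun t : ℝ => x + t • v) v 0 := by
    simpa using ((hasDerivAt_id (0 : ℝ)).smul_const v).const_add x
  have hn := hp.norm_sq
  have hx0 : ‖x + (0 : ℝ) • v‖ ^ 2 ≠ 0 := by simpa using hx
  refine ((hn.fun_inv hx0).smul hp).congr_deriv ?_
  simp only [zero_smul, add_zero]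
  rw [sub_eq_add_neg, ← neg_smul]
  congr 2
  field_simp

theorem hasDerivAt_inv_norm_sq_pow_line {x : E} (v : E) (hx : x ≠ 0) (k : ℕ) :
    HasDerivAt (fun t : ℝ => ((‖x + t • v‖ ^ 2)⁻¹) ^ k)
      (-(2 * k * ⟪x, v⟫ * ((‖x‖ ^ 2)⁻¹) ^ (k + 1))) 0 := by
  have hp : HasDerivAt (fun t : ℝ => x + t • v) v 0 := by
    simpa using ((hasDerivAt_id (0 : ℝ)).smul_const v).const_add x
  have hx0 : ‖x + (0 : ℝ) • v‖ ^ 2 ≠ 0 := by simpa using hx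
  have h := (hp.norm_sq.fun_inv hx0).fun_pow k
  refine h.congr_deriv ?_
  simp only [zero_smul, add_zero]
  rcases k with _ | k
  · simp
  · simp only [Nat.add_sub_cancel]
    have hx' : ‖x‖ ≠ 0 := by simpa using hx
    simp only [inv_pow]
    push_cast
    field_simp
    ring

/-- The Kelvin transform of `h`, in dimension eight. -/
def kelvin (h : E → ℝ) (x : E) : ℝ := ((‖x‖ ^ 2)⁻¹) ^ 3 * h ((‖x‖ ^ 2)⁻¹ • x)

theorem contDiffAt_inversion {n : WithTop ℕ∞} {x : E} (hx : x ≠ 0) :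
    ContDiffAt ℝ n (fun y : E => (‖y‖ ^ 2)⁻¹ • y) x := by
  have h : ContDiffAt ℝ n (fun y : E => (‖y‖ ^ 2)⁻¹) x :=
    (contDiff_norm_sq ℝ).contDiffAt.inv (by simpa using hx)
  exact h.smul contDiffAt_id

theorem contDiffAt_kelvin {n : WithTop ℕ∞} {h : E → ℝ} {x : E} (hx : x ≠ 0)
    (hh : ContDiffAt ℝ n h ((‖x‖ ^ 2)⁻¹ • x)) : ContDiffAt ℝ n (kelvin h) x := by
  have h1 : ContDiffAt ℝ n (fun y : E => (‖y‖ ^ 2)⁻¹) x :=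
    (contDiff_norm_sq ℝ).contDiffAt.inv (by simpa using hx)
  exact (h1.pow 3).mul (ContDiffAt.comp x hh (contDiffAt_inversion hx))

theorem fderiv_kelvin_apply {h : E → ℝ} {x : E} (hx : x ≠ 0)
    (hh : ContDiffAt ℝ 1 h ((‖x‖ ^ 2)⁻¹ • x)) (v : E) :
    fderiv ℝ (kelvin h) x v =
      -6 * ⟪x, v⟫ * ((‖x‖ ^ 2)⁻¹) ^ 4 * h ((‖x‖ ^ 2)⁻¹ • x)
        + ((‖x‖ ^ 2)⁻¹) ^ 4 * fderiv ℝ h ((‖x‖ ^ 2)⁻¹ • x) v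
        - 2 * ⟪x, v⟫ * ((‖x‖ ^ 2)⁻¹) ^ 5 * fderiv ℝ h ((‖x‖ ^ 2)⁻¹ • x) x := by
  have hp : HasDerivAt (fun t : ℝ => x + t • v) v 0 := by
    simpa using ((hasDerivAt_id (0 : ℝ)).smul_const v).const_add x
  have hK : HasFDerivAt (kelvin h) (fderiv ℝ (kelvin h) x) (x + (0 : ℝ) • v) := by
    simpa using ((contDiffAt_kelvin hx hh).differentiableAt (by norm_num)).hasFDerivAt
  have hK' : HasDerivAt (fun t : ℝ => kelvin h (x + t • v)) (fderiv ℝ (kelvin h) x v) 0 := by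
    have := hK.comp_hasDerivAt (0 : ℝ) hp
    exact this
  have hh' : HasFDerivAt h (fderiv ℝ h ((‖x‖ ^ 2)⁻¹ • x))
      ((‖x + (0 : ℝ) • v‖ ^ 2)⁻¹ • (x + (0 : ℝ) • v)) := by
    simpa using (hh.differentiableAt (by norm_num)).hasFDerivAt
  have h1 := (hasDerivAt_inv_norm_sq_pow_line v hx 3).mul
    (hh'.comp_hasDerivAt (0 : ℝ) (hasDerivAt_inversion_line (v := v) hx))
  refine hK'.unique (h1.congr_deriv ?_)
  simp only [Function.comp, zero_smul, add_zero, map_sub, map_smul, smul_eq_mul]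
  push_cast
  ring

/-- The derivative is grouped by its dependence on v (‖v‖², ⟪x, v⟫², ⟪x, v⟫ L v, and the B terms),
so that each group can be summed in closed form over an orthonormal basis. -/
theorem hasDerivAt_fderiv_kelvin_line {h : E → ℝ} {x : E} (hx : x ≠ 0)
    (hh : ContDiffAt ℝ 2 h ((‖x‖ ^ 2)⁻¹ • x)) (v : E) :
    HasDerivAt (fun t : ℝ => (fun y => -6 * ⟪y, v⟫ * ((‖y‖ ^ 2)⁻¹) ^ 4 * h ((‖y‖ ^ 2)⁻¹ • y)
        + ((‖y‖ ^ 2)⁻¹) ^ 4 * fderiv ℝ h ((‖y‖ ^ 2)⁻¹ • y) v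
        - 2 * ⟪y, v⟫ * ((‖y‖ ^ 2)⁻¹) ^ 5 * fderiv ℝ h ((‖y‖ ^ 2)⁻¹ • y) y) (x + t • v))
      (let N := (‖x‖ ^ 2)⁻¹
       let A := h (N • x)
       let L := fderiv ℝ h (N • x)
       let B := fderiv ℝ (fderiv ℝ h) (N • x)
       (-6 * N ^ 4 * A - 2 * N ^ 5 * L x) * ‖v‖ ^ 2
        + (48 * N ^ 5 * A + 32 * N ^ 6 * L x + 4 * N ^ 7 * B x x) * ⟪x, v⟫ ^ 2
        + (-16 * N ^ 5) * (⟪x, v⟫ * L v) + N ^ 5 * B v v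
        + (-2 * N ^ 6) * (⟪x, v⟫ * B x v) + (-2 * N ^ 6) * (⟪x, v⟫ * B v x)) 0 := by
  have hp : HasDerivAt (fun t : ℝ => x + t • v) v 0 := by
    simpa using ((hasDerivAt_id (0 : ℝ)).smul_const v).const_add x
  have hι := hasDerivAt_inversion_line (v := v) hx
  have hh' : HasFDerivAt h (fderiv ℝ h ((‖x‖ ^ 2)⁻¹ • x))
      ((‖x + (0 : ℝ) • v‖ ^ 2)⁻¹ • (x + (0 : ℝ) • v)) := by
    simpa using (hh.differentiableAt (by norm_num)).hasFDerivAt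
  have hh'' : HasFDerivAt (fderiv ℝ h) (fderiv ℝ (fderiv ℝ h) ((‖x‖ ^ 2)⁻¹ • x))
      ((‖x + (0 : ℝ) • v‖ ^ 2)⁻¹ • (x + (0 : ℝ) • v)) := by
    simpa using ((hh.fderiv_right (m := 1) (by norm_num)).differentiableAt
      (by norm_num)).hasFDerivAt
  have hm : HasDerivAt (fun t : ℝ => ⟪x + t • v, v⟫) (⟪v, v⟫) 0 := by
    simpa using hp.inner ℝ (hasDerivAt_const (0 : ℝ) v)
  have hA := hh'.comp_hasDerivAt (0 : ℝ) hι
  have hL := hh''.comp_hasDerivAt (0 : ℝ) hι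
  have h4 := hasDerivAt_inv_norm_sq_pow_line v hx 4
  have h5 := hasDerivAt_inv_norm_sq_pow_line v hx 5
  have := ((((hm.const_mul (-6)).mul h4).mul hA).add
    (h4.mul (hL.clm_apply (hasDerivAt_const (0 : ℝ) v)))).sub
    (((hm.const_mul 2).mul h5).mul (hL.clm_apply hp))
  refine this.congr_deriv ?_
  simp only [Function.comp, Pi.mul_apply, zero_smul, add_zero, map_sub, map_smul, smul_eq_mul,
    real_inner_self_eq_norm_sq, map_zero, sub_apply,
    smul_apply]
  push_cast
  ring

variable [FiniteDimensional ℝ E]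

theorem laplacian_comp_isometry (f : E → ℝ) (L : E ≃ₗᵢ[ℝ] E) (x : E) :
    Δ (fun y => f (L y)) x = Δ f (L x) := by
  rw [laplacian_eq_iteratedFDeriv_orthonormalBasis _ (stdOrthonormalBasis ℝ E),
    laplacian_eq_iteratedFDeriv_orthonormalBasis _ ((stdOrthonormalBasis ℝ E).map L)]
  have key := L.toContinuousLinearEquiv.iteratedFDerivWithin_comp_right f uniqueDiffOn_univ
    (Set.mem_univ (L.toContinuousLinearEquiv x)) 2
  rw [Set.preimage_univ, iteratedFDerivWithin_univ, iteratedFDerivWithin_univ] at key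
  refine Finset.sum_congr rfl fun i _ => ?_
  have := congrArg (fun T => T ![stdOrthonormalBasis ℝ E i, stdOrthonormalBasis ℝ E i]) key
  refine this.trans ?_
  simp only [ContinuousMultilinearMap.compContinuousLinearMap_apply, OrthonormalBasis.map_apply]
  congr 1
  ext j
  fin_cases j <;> rfl

theorem laplacian_comp_smul (f : E → ℝ) {c : ℝ} (hc : c ≠ 0) (x : E) :
    Δ (fun y => f (c • y)) x = c ^ 2 * Δ f (c • x) := by
  rw [laplacian_eq_iteratedFDeriv_orthonormalBasis _ (stdOrthonormalBasis ℝ E),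
    laplacian_eq_iteratedFDeriv_orthonormalBasis _ (stdOrthonormalBasis ℝ E)]
  let L : E ≃L[ℝ] E := ContinuousLinearEquiv.smulLeft (Units.mk0 c hc)
  have key := L.iteratedFDerivWithin_comp_right f uniqueDiffOn_univ (Set.mem_univ (L x)) 2
  rw [Set.preimage_univ, iteratedFDerivWithin_univ, iteratedFDerivWithin_univ] at key
  rw [Finset.mul_sum]
  refine Finset.sum_congr rfl fun i _ => ?_
  have := congrArg (fun T => T ![stdOrthonormalBasis ℝ E i, stdOrthonormalBasis ℝ E i]) key
  refine this.trans ?_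
  simp only [ContinuousMultilinearMap.compContinuousLinearMap_apply]
  have h2 := (iteratedFDeriv ℝ 2 f (L x)).map_smul_univ (fun _ => c)
    ![stdOrthonormalBasis ℝ E i, stdOrthonormalBasis ℝ E i]
  simp only [Finset.prod_const, Finset.card_univ, Fintype.card_fin, smul_eq_mul] at h2
  exact h2

theorem laplacian_comp_add (f : E → ℝ) (b x : E) :
    Δ (fun y => f (y + b)) x = Δ f (x + b) := by
  rw [laplacian_eq_iteratedFDeriv_orthonormalBasis _ (stdOrthonormalBasis ℝ E),
    laplacian_eq_iteratedFDeriv_orthonormalBasis _ (stdOrthonormalBasis ℝ E)]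
  simp only [iteratedFDeriv_comp_add_right]

theorem InnerProductSpace.HarmonicAt.comp_similarity {f : E → ℝ} (L : E ≃ₗᵢ[ℝ] E) {c : ℝ}
    (hc : c ≠ 0) (b : E) {x : E} (hf : HarmonicAt f (c • L x + b)) :
    HarmonicAt (fun y => f (c • L y + b)) x := by
  have hcont : Continuous fun y => c • L y + b := by fun_prop
  refine ⟨ContDiffAt.comp x hf.1 (by fun_prop), ?_⟩
  have h := hcont.continuousAt.eventually hf.eventually
  filter_upwards [h] with y hy
  rw [laplacian_comp_isometry (fun z => f (c • z + b)) L y,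
    laplacian_comp_smul (fun z => f (z + b)) hc, laplacian_comp_add, hy.2.self_of_nhds]
  simp

/-- Tracing the second derivatives over an orthonormal basis leaves terms in h, Dh(x) and D²h(x, x),
besides a multiple of the vanishing Laplacian of h. With N‖x‖² = 1 their coefficients are -48 + 48,
-16 + 32 - 16 and 4 - 2 - 2. The dimension enters through ∑ ‖eᵢ‖² = 8, which matches the weight
exponent to make the first two cancel. -/
theorem laplacian_kelvin (hE : Module.finrank ℝ E = 8) {h : E → ℝ} {x : E} (hx : x ≠ 0)
    (hh : HarmonicAt h ((‖x‖ ^ 2)⁻¹ • x)) : Δ (kelvin h) x = 0 := by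
  let e := stdOrthonormalBasis ℝ E
  have hlap : Δ h ((‖x‖ ^ 2)⁻¹ • x) = 0 := hh.2.self_of_nhds
  rw [laplacian_eq_iteratedFDeriv_orthonormalBasis _ e] at hlap ⊢
  simp only [iteratedFDeriv_two_apply, Matrix.cons_val_zero, Matrix.cons_val_one] at hlap
  have hev : ∀ᶠ y in 𝓝 x, y ≠ 0 ∧ ContDiffAt ℝ 1 h ((‖y‖ ^ 2)⁻¹ • y) := by
    refine (eventually_ne_nhds hx).and ?_
    have hc := (contDiffAt_inversion (n := 1) hx).continuousAt
    exact hc.eventually (hh.eventually.mono fun z hz => hz.1.of_le (by norm_num))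
  have key : ∀ i, iteratedFDeriv ℝ 2 (kelvin h) x ![e i, e i] = _ := fun i =>
    iteratedFDeriv_two_apply_eq_of_hasDerivAt (contDiffAt_kelvin hx hh.1)
      (hev.mono fun y hy => fderiv_kelvin_apply hy.1 hy.2 (e i))
      (hasDerivAt_fderiv_kelvin_line hx hh.1 (e i))
  simp only [key]
  set N := (‖x‖ ^ 2)⁻¹ with hN
  set L := fderiv ℝ h (N • x)
  set B := fderiv ℝ (fderiv ℝ h) (N • x)
  have hexp : ∑ i, ⟪x, e i⟫ • e i = x := by
    simpa only [real_inner_comm] using e.sum_repr' x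
  have s1 : ∑ i, ‖e i‖ ^ 2 = 8 := by simp [hE]
  have s2 : ∑ i, ⟪x, e i⟫ ^ 2 = ‖x‖ ^ 2 := by
    rw [← real_inner_self_eq_norm_sq, ← e.sum_inner_mul_inner x x]
    refine Finset.sum_congr rfl fun i _ => ?_
    rw [real_inner_comm x (e i), sq]
  have s3 : ∀ l : E →L[ℝ] ℝ, ∑ i, ⟪x, e i⟫ * l (e i) = l x := fun l => by
    conv_rhs => rw [← hexp]
    simp
  have s4 : ∑ i, ⟪x, e i⟫ * B (e i) x = B x x := s3 (B.flip x)
  simp only [Finset.sum_add_distrib, ← Finset.mul_sum, s1, s2, s3, s4, hlap]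
  have hxN : N * ‖x‖ ^ 2 = 1 := inv_mul_cancel₀ (by simpa using hx)
  linear_combination (48 * N ^ 4 * h (N • x) + 32 * N ^ 5 * L x + 4 * N ^ 6 * B x x) * hxN

theorem InnerProductSpace.HarmonicAt.kelvin (hE : Module.finrank ℝ E = 8) {h : E → ℝ} {x : E}
    (hx : x ≠ 0) (hh : HarmonicAt h ((‖x‖ ^ 2)⁻¹ • x)) : HarmonicAt (kelvin h) x := by
  refine ⟨contDiffAt_kelvin hx hh.1, ?_⟩
  have hc := (contDiffAt_inversion (n := 1) hx).continuousAt
  filter_upwards [eventually_ne_nhds hx, hc.eventually hh.eventually] with y hy hy'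
  exact laplacian_kelvin hE hy hy'

end Harmonic

/-! ### Transfer of subharmonicity through weighted changes of variable. -/

section Subharmonic

open InnerProductSpace Filter Topology Set

theorem EReal.coe_mul_le_coe_iff {w : ℝ} (hw : 0 < w) {a : EReal} {c : ℝ} :
    (w : EReal) * a ≤ c ↔ a ≤ ((c / w : ℝ) : EReal) := by
  induction a with
  | bot => simp [EReal.coe_mul_bot_of_pos hw]
  | coe a => rw [← EReal.coe_mul, EReal.coe_le_coe_iff, EReal.coe_le_coe_iff, le_div_iff₀' hw]
  | top => simp [EReal.coe_mul_top_of_pos hw]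

theorem EReal.coe_mul_lt_top {w : ℝ} (hw : 0 < w) {a : EReal} (ha : a < ⊤) :
    (w : EReal) * a < ⊤ := by
  induction a with
  | bot => simp [EReal.coe_mul_bot_of_pos hw]
  | coe a => rw [← EReal.coe_mul]; exact EReal.coe_lt_top _
  | top => exact absurd ha (lt_irrefl _)

theorem EReal.coe_mul_lt_coe_iff {w : ℝ} (hw : 0 < w) {a : EReal} {c : ℝ} :
    (w : EReal) * a < c ↔ a < ((c / w : ℝ) : EReal) := by
  induction a with
  | bot => simp [EReal.coe_mul_bot_of_pos hw]
  | coe a => rw [← EReal.coe_mul, EReal.coe_lt_coe_iff, EReal.coe_lt_coe_iff, lt_div_iff₀' hw]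
  | top => simp [EReal.coe_mul_top_of_pos hw]

theorem UpperSemicontinuousOn.congr_eqOn {X Y : Type*} [TopologicalSpace X] [Preorder Y]
    {f g : X → Y} {s : Set X} (hf : UpperSemicontinuousOn f s) (hfg : EqOn f g s) :
    UpperSemicontinuousOn g s := by
  intro x hx y hy
  filter_upwards [hf x hx y ((hfg hx).trans_lt hy), self_mem_nhdsWithin] with z hz hzs
  exact (hfg hzs).symm.trans_lt hz

/-- Since w > 0, the inequality w f < y means f < y / w; a real number strictly between f(x) and y /
w(x) absorbs the variation of w. Finiteness from above is needed only for y = ⊤. -/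
theorem UpperSemicontinuousOn.coe_mul {X : Type*} [TopologicalSpace X] {w : X → ℝ} {f : X → EReal}
    {s : Set X} (hf : UpperSemicontinuousOn f s) (htop : ∀ x ∈ s, f x < ⊤) (hw : ContinuousOn w s)
    (hpos : ∀ x ∈ s, 0 < w x) : UpperSemicontinuousOn (fun x => (w x : EReal) * f x) s := by
  intro x hx y hy
  induction y with
  | bot => exact absurd hy not_lt_bot
  | top =>
    filter_upwards [self_mem_nhdsWithin] with z hz
    exact EReal.coe_mul_lt_top (hpos z hz) (htop z hz)
  | coe y =>
    obtain ⟨r, hr, hr'⟩ := EReal.lt_iff_exists_real_btwn.1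
      ((EReal.coe_mul_lt_coe_iff (hpos x hx)).1 hy)
    have h1 : ∀ᶠ z in 𝓝[s] x, r < y / w z :=
      (continuousWithinAt_const.div (hw x hx) (hpos x hx).ne').eventually
        (lt_mem_nhds (EReal.coe_lt_coe_iff.1 hr'))
    filter_upwards [hf x hx r hr, h1, self_mem_nhdsWithin] with z hz hz' hzs
    exact (EReal.coe_mul_lt_coe_iff (hpos z hzs)).2 (hz.trans (EReal.coe_lt_coe_iff.2 hz'))

variable {E : Type*} [NormedAddCommGroup E] [InnerProductSpace ℝ E] [FiniteDimensional ℝ E]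

namespace Octonion

theorem SubharmonicOn.congr {f g : E → EReal} {Ω : Set E} (hf : SubharmonicOn f Ω)
    (hfg : EqOn f g Ω) : SubharmonicOn g Ω := by
  refine ⟨hf.1.congr_eqOn hfg, fun x hx => hfg hx ▸ hf.2.1 x hx, fun G h hG hc hsub hh hle x hx => ?_⟩
  rw [← hfg (hsub (subset_closure hx))]
  exact hf.2.2 G h hG hc hsub hh
    (fun y hy => (hfg (hsub (frontier_subset_closure hy))).trans_le (hle y hy)) x hx

/-- A harmonic majorant h of w · (f ∘ φ) on the boundary of G becomes the majorant (h / w) ∘ φ⁻¹ of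
f on the boundary of φ(G). It is enough that this transfer preserve harmonicity, which is `hharm`.
-/
theorem SubharmonicOn.weighted_comp {f : E → EReal} {Ω Ω' : Set E} (φ : OpenPartialHomeomorph E E)
    {w : E → ℝ} (hf : SubharmonicOn f Ω') (hΩ : Ω ⊆ φ.source) (hmaps : MapsTo φ Ω Ω')
    (hw : ContinuousOn w Ω) (hpos : ∀ x ∈ Ω, 0 < w x)
    (hharm : ∀ (h : E → ℝ), ∀ x ∈ Ω, HarmonicAt h x →
      HarmonicAt (fun y => h (φ.symm y) / w (φ.symm y)) (φ x)) :
    SubharmonicOn (fun x => (w x : EReal) * f (φ x)) Ω := by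
  refine ⟨(hf.1.comp (φ.continuousOn.mono hΩ) hmaps).coe_mul (fun x hx => hf.2.1 _ (hmaps hx)) hw
    hpos, fun x hx => EReal.coe_mul_lt_top (hpos x hx) (hf.2.1 _ (hmaps hx)), ?_⟩
  intro G h hG hcpt hsub hh hle x hx
  have hGs : closure G ⊆ φ.source := hsub.trans hΩ
  have hcpt' : IsCompact (φ '' closure G) := hcpt.image_of_continuousOn (φ.continuousOn.mono hGs)
  -- By compactness φ creates no closure points beyond the image of `closure G`; hence every
  -- frontier point of φ(G) comes from a frontier point of G.
  have hcl : closure (φ '' G) ⊆ φ '' closure G :=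
    closure_minimal (image_mono subset_closure) hcpt'.isClosed
  have hopen : IsOpen (φ '' G) :=
    φ.isOpen_image_of_subset_source hG (subset_closure.trans hGs)
  rw [EReal.coe_mul_le_coe_iff (hpos x (hsub (subset_closure hx)))]
  have key := hf.2.2 (φ '' G) (fun y => h (φ.symm y) / w (φ.symm y)) hopen
    (hcpt'.of_isClosed_subset isClosed_closure hcl)
    (hcl.trans ((image_mono hsub).trans hmaps.image_subset)) ⟨?_, ?_⟩ ?_ (φ x)
    (mem_image_of_mem φ hx)
  · simpa only [φ.left_inv (hGs (subset_closure hx))] using key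
  · rintro _ ⟨y, hy, rfl⟩
    exact hharm h y (hsub (subset_closure hy)) (hh.harmonicOnNhd y hy)
  · have h1 : ContinuousOn (fun x => h x / w x) (closure G) :=
      hh.continuousOn.div (hw.mono hsub) fun y hy => (hpos y (hsub hy)).ne'
    have h2 : MapsTo φ.symm (closure (φ '' G)) (closure G) := by
      intro y hy
      obtain ⟨z, hz, rfl⟩ := hcl hy
      rwa [φ.left_inv (hGs hz)]
    refine h1.comp (φ.symm.continuousOn.mono ?_) h2
    exact hcl.trans ((image_mono hGs).trans φ.image_source_eq_target.subset)
  · intro y hy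
    rw [hopen.frontier_eq] at hy
    obtain ⟨z, hz, rfl⟩ := hcl hy.1
    have hzG : z ∉ G := fun hzG => hy.2 (mem_image_of_mem φ hzG)
    rw [φ.left_inv (hGs hz), ← EReal.coe_mul_le_coe_iff (hpos z (hsub hz))]
    exact hle z (by rw [hG.frontier_eq]; exact ⟨hz, hzG⟩)

theorem SubharmonicOn.comp_similarity {f : E → EReal} {Ω Ω' : Set E} (hf : SubharmonicOn f Ω')
    (L : E ≃ₗᵢ[ℝ] E) {c k : ℝ} (hc : c ≠ 0) (hk : 0 < k) (b : E)
    (hmaps : MapsTo (fun x => c • L x + b) Ω Ω') :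
    SubharmonicOn (fun x => (k : EReal) * f (c • L x + b)) Ω := by
  let φ : E ≃ₜ E := (L.toHomeomorph.trans (Homeomorph.smulOfNeZero c hc)).trans
    (Homeomorph.addRight b)
  have hsymm : ∀ y, φ.symm y = c⁻¹ • L.symm y + -(c⁻¹ • L.symm b) := by
    intro y
    apply φ.injective
    rw [φ.apply_symm_apply]
    change y = c • L (c⁻¹ • L.symm y + -(c⁻¹ • L.symm b)) + b
    simp [smul_smul, hc]
  refine hf.weighted_comp φ.toOpenPartialHomeomorph (w := fun _ => k) (subset_univ _) hmaps
    continuousOn_const (fun _ _ => hk) ?_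
  intro h x _ hh
  have hx : x = c⁻¹ • L.symm (φ x) + -(c⁻¹ • L.symm b) := by
    rw [← hsymm, φ.symm_apply_apply]
  rw [hx] at hh
  have h1 := (hh.comp_similarity L.symm (inv_ne_zero hc) _).const_smul (c := k⁻¹)
  refine (harmonicAt_congr_nhds (Eventually.of_forall fun y => ?_)).1 h1
  simp only [Pi.smul_apply, smul_eq_mul]
  change _ = h (φ.symm y) / k
  rw [hsymm, div_eq_inv_mul]

/-- The inversion `x ↦ L (x / ‖x‖²)` with respect to the unit sphere, followed by an isometry. -/
def isometryInversion (L : E ≃ₗᵢ[ℝ] E) (hL : ∀ x, L (L x) = x) : OpenPartialHomeomorph E E where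
  toFun x := (‖x‖ ^ 2)⁻¹ • L x
  invFun x := (‖x‖ ^ 2)⁻¹ • L x
  source := {0}ᶜ
  target := {0}ᶜ
  map_source' x hx := by simpa using hx
  map_target' x hx := by simpa using hx
  left_inv' x hx := by
    have hx' : ‖x‖ ≠ 0 := by simpa using hx
    simp only [map_smul, hL, norm_smul, norm_inv, norm_pow, norm_norm, L.norm_map, smul_smul]
    field_simp
    simp
  right_inv' x hx := by
    have hx' : ‖x‖ ≠ 0 := by simpa using hx
    simp only [map_smul, hL, norm_smul, norm_inv, norm_pow, norm_norm, L.norm_map, smul_smul]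
    field_simp
    simp
  open_source := isOpen_compl_singleton
  open_target := isOpen_compl_singleton
  continuousOn_toFun := by
    intro x hx
    have hx' : ‖x‖ ^ 2 ≠ 0 := by simpa using hx
    exact ((continuous_norm.pow 2).continuousAt.inv₀ hx' |>.smul
      L.continuous.continuousAt).continuousWithinAt
  continuousOn_invFun := by
    intro x hx
    have hx' : ‖x‖ ^ 2 ≠ 0 := by simpa using hx
    exact ((continuous_norm.pow 2).continuousAt.inv₀ hx' |>.smul
      L.continuous.continuousAt).continuousWithinAt

/-- The map x ↦ L x / ‖x‖² is its own inverse, and 1 / w at the inverse image of z is ‖z‖⁻⁶. The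
transferred harmonic function is therefore the Kelvin transform of h ∘ L. -/
theorem SubharmonicOn.comp_inversion (hE : Module.finrank ℝ E = 8) {f : E → EReal} {Ω Ω' : Set E}
    (hf : SubharmonicOn f Ω') (L : E ≃ₗᵢ[ℝ] E) (hL : ∀ x, L (L x) = x) (h0 : ∀ x ∈ Ω, x ≠ 0)
    (hmaps : MapsTo (fun x => (‖x‖ ^ 2)⁻¹ • L x) Ω Ω') :
    SubharmonicOn (fun x => (((‖x‖ ^ 6)⁻¹ : ℝ) : EReal) * f ((‖x‖ ^ 2)⁻¹ • L x)) Ω := by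
  refine hf.weighted_comp (isometryInversion L hL) (w := fun x => (‖x‖ ^ 6)⁻¹) h0 hmaps ?_ ?_ ?_
  · exact (continuous_norm.pow 6).continuousOn.inv₀ fun x hx => by simpa using h0 x hx
  · intro x hx
    have := norm_pos_iff.2 (h0 x hx)
    positivity
  · intro h x hx hh
    set y := isometryInversion L hL x
    have hy0 : y ≠ 0 := (isometryInversion L hL).map_source (h0 x hx)
    have hxy : x = (‖y‖ ^ 2)⁻¹ • L y := ((isometryInversion L hL).left_inv (h0 x hx)).symm
    have h1 : HarmonicAt (fun z => h ((1 : ℝ) • L z + 0)) ((‖y‖ ^ 2)⁻¹ • y) := by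
      refine InnerProductSpace.HarmonicAt.comp_similarity L one_ne_zero 0 ?_
      rwa [map_smul, one_smul, add_zero, ← hxy]
    refine (harmonicAt_congr_nhds ?_).1 (h1.kelvin hE hy0)
    filter_upwards [eventually_ne_nhds hy0] with z hz
    change _ = h ((‖z‖ ^ 2)⁻¹ • L z) / (‖(‖z‖ ^ 2)⁻¹ • L z‖ ^ 6)⁻¹
    have hz' : ‖z‖ ≠ 0 := by simpa using hz
    simp only [kelvin, one_smul, add_zero, map_smul, norm_smul, norm_inv, norm_pow, norm_norm,
      L.norm_map, div_inv_eq_mul]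
    rw [mul_comm]
    congr 1
    field_simp

end Octonion

end Subharmonic

/-! ### Octonion algebra: bilinearity, multiplicativity of the norm, alternative laws. -/

namespace Octonion

open scoped RealInnerProductSpace

@[ext]
theorem ext {x y : Octonion} (h₁ : x.fst = y.fst) (h₂ : x.snd = y.snd) : x = y :=
  WithLp.ofLp_injective 2 (Prod.ext h₁ h₂)

@[simp] theorem mul_fst (x y : Octonion) : (x * y).fst = x.fst * y.fst - star y.snd * x.snd := rfl
@[simp] theorem mul_snd (x y : Octonion) : (x * y).snd = y.snd * x.fst + x.snd * star y.fst := rfl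
@[simp] theorem one_fst : (1 : Octonion).fst = 1 := rfl
@[simp] theorem one_snd : (1 : Octonion).snd = 0 := rfl
@[simp] theorem conj_fst (x : Octonion) : (conj x).fst = star x.fst := rfl
@[simp] theorem conj_snd (x : Octonion) : (conj x).snd = -x.snd := rfl

theorem inv_def (x : Octonion) : x⁻¹ = (‖x‖ ^ 2)⁻¹ • conj x := rfl

theorem norm_sq_eq (x : Octonion) : ‖x‖ ^ 2 = ‖x.fst‖ ^ 2 + ‖x.snd‖ ^ 2 :=
  WithLp.prod_norm_sq_eq_of_L2 x

theorem quaternion_norm_sq (q : Quaternion ℝ) :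
    ‖q‖ ^ 2 = q.re ^ 2 + q.imI ^ 2 + q.imJ ^ 2 + q.imK ^ 2 := by
  rw [sq, ← Quaternion.normSq_eq_norm_mul_self, Quaternion.normSq_def']

protected theorem mul_add (x y z : Octonion) : x * (y + z) = x * y + x * z := by
  ext1 <;> simp [mul_add, add_mul] <;> abel

protected theorem add_mul (x y z : Octonion) : (x + y) * z = x * z + y * z := by
  ext1 <;> simp [mul_add, add_mul] <;> abel

protected theorem mul_smul (c : ℝ) (x y : Octonion) : x * (c • y) = c • (x * y) := by
  ext1 <;> simp [smul_sub, smul_add]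

protected theorem smul_mul (c : ℝ) (x y : Octonion) : (c • x) * y = c • (x * y) := by
  ext1 <;> simp [smul_sub, smul_add]

protected theorem one_mul (x : Octonion) : 1 * x = x := by
  ext1 <;> simp

protected theorem mul_one (x : Octonion) : x * 1 = x := by
  ext1 <;> simp

/-- In real coordinates this is the eight-square identity. -/
protected theorem norm_mul (x y : Octonion) : ‖x * y‖ = ‖x‖ * ‖y‖ := by
  rw [← sq_eq_sq₀ (norm_nonneg _) (by positivity), mul_pow]
  simp only [norm_sq_eq, quaternion_norm_sq]
  simp
  ring

/-- This and `mul_mul_conj` replace associativity: they are what makes cancellation of an inverse on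
either side possible. -/
theorem conj_mul_mul (x y : Octonion) : conj x * (x * y) = ‖x‖ ^ 2 • y := by
  simp only [norm_sq_eq, quaternion_norm_sq]
  ext <;> simp <;> ring

theorem mul_mul_conj (x y : Octonion) : y * x * conj x = ‖x‖ ^ 2 • y := by
  simp only [norm_sq_eq, quaternion_norm_sq]
  ext <;> simp <;> ring

/-- Octonionic conjugation as a linear isometry. -/
def conjIsometry : Octonion ≃ₗᵢ[ℝ] Octonion where
  toFun := conj
  invFun := conj
  left_inv x := by ext1 <;> simp
  right_inv x := by ext1 <;> simp
  map_add' x y := by ext1 <;> simp [add_comm]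
  map_smul' c x := by ext1 <;> simp
  norm_map' x := by
    rw [← sq_eq_sq₀ (norm_nonneg _) (norm_nonneg _), norm_sq_eq, norm_sq_eq]
    simp

theorem finrank_eq_eight : Module.finrank ℝ Octonion = 8 := by
  rw [(WithLp.linearEquiv 2 ℝ (Quaternion ℝ × Quaternion ℝ)).finrank_eq, Module.finrank_prod,
    Quaternion.finrank_eq_four]

theorem inner_eq_re (x y : Octonion) : ⟪x, y⟫ = re (conj x * y) := by
  rw [WithLp.prod_inner_apply]
  simp [re, Quaternion.inner_def]
  ring

end Octonion

/-! ### Octonion inverses, the Cayley transform and the Siegel half space. -/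

namespace Octonion

open scoped RealInnerProductSpace
open Set

@[simp] theorem pt_fst (x y : Octonion) : (pt x y).fst = x := rfl
@[simp] theorem pt_snd (x y : Octonion) : (pt x y).snd = y := rfl

theorem plane_ext {x y : OctonionPlane} (h₁ : x.fst = y.fst) (h₂ : x.snd = y.snd) : x = y :=
  WithLp.ofLp_injective 2 (Prod.ext h₁ h₂)

theorem plane_norm_sq (x : OctonionPlane) : ‖x‖ ^ 2 = ‖x.fst‖ ^ 2 + ‖x.snd‖ ^ 2 :=
  WithLp.prod_norm_sq_eq_of_L2 x

protected theorem zero_mul (x : Octonion) : 0 * x = 0 := by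
  simpa using Octonion.smul_mul 0 0 x

protected theorem neg_mul (x y : Octonion) : -x * y = -(x * y) := by
  simpa using Octonion.smul_mul (-1) x y

protected theorem mul_neg (x y : Octonion) : x * -y = -(x * y) := by
  simpa using Octonion.mul_smul (-1) x y

protected theorem sub_mul (x y z : Octonion) : (x - y) * z = x * z - y * z := by
  rw [sub_eq_add_neg, Octonion.add_mul, Octonion.neg_mul, sub_eq_add_neg]

theorem conj_smul (c : ℝ) (x : Octonion) : conj (c • x) = c • conj x := conjIsometry.map_smul c x

theorem conj_neg (x : Octonion) : conj (-x) = -conj x := conjIsometry.map_neg x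

theorem conj_conj (x : Octonion) : conj (conj x) = x := conjIsometry.left_inv x

theorem norm_conj (x : Octonion) : ‖conj x‖ = ‖x‖ := conjIsometry.norm_map x

theorem conj_mul_self (x : Octonion) : conj x * x = ‖x‖ ^ 2 • (1 : Octonion) := by
  simpa [Octonion.mul_one] using conj_mul_mul x 1

protected theorem norm_one : ‖(1 : Octonion)‖ = 1 := by
  rw [← sq_eq_sq₀ (norm_nonneg _) zero_le_one, norm_sq_eq]
  simp

@[simp] theorem re_add (x y : Octonion) : re (x + y) = re x + re y := rfl
@[simp] theorem re_sub (x y : Octonion) : re (x - y) = re x - re y := rfl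
@[simp] theorem re_neg (x : Octonion) : re (-x) = -re x := rfl
@[simp] theorem re_smul (c : ℝ) (x : Octonion) : re (c • x) = c * re x := rfl
@[simp] theorem re_one : re 1 = 1 := rfl
@[simp] theorem re_zero : re 0 = 0 := rfl
@[simp] theorem re_conj (x : Octonion) : re (conj x) = re x := by simp [re]

theorem norm_one_add_sq (x : Octonion) : ‖1 + x‖ ^ 2 = 1 + 2 * re x + ‖x‖ ^ 2 := by
  have h : conj 1 = 1 := by ext1 <;> simp
  rw [norm_add_sq_real, inner_eq_re, h, Octonion.one_mul, Octonion.norm_one]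
  ring

protected theorem norm_inv (x : Octonion) : ‖x⁻¹‖ = ‖x‖⁻¹ := by
  rcases eq_or_ne x 0 with rfl | hx
  · simp [inv_def]
  · have : ‖x‖ ≠ 0 := norm_ne_zero_iff.2 hx
    rw [inv_def, norm_smul, norm_conj, norm_inv, norm_pow, norm_norm]
    field_simp

protected theorem inv_ne_zero {x : Octonion} (hx : x ≠ 0) : x⁻¹ ≠ 0 := by
  rw [← norm_ne_zero_iff, Octonion.norm_inv]
  exact _root_.inv_ne_zero (norm_ne_zero_iff.2 hx)

protected theorem inv_inv {x : Octonion} (hx : x ≠ 0) : x⁻¹⁻¹ = x := by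
  have h : ‖x‖ ≠ 0 := norm_ne_zero_iff.2 hx
  rw [inv_def x⁻¹, Octonion.norm_inv, inv_def x, conj_smul, conj_conj, smul_smul]
  field_simp
  simp

protected theorem smul_inv (c : ℝ) (x : Octonion) : (c • x)⁻¹ = c⁻¹ • x⁻¹ := by
  rcases eq_or_ne c 0 with rfl | hc
  · simp [inv_def]
  · rw [inv_def, inv_def, conj_smul, smul_smul, smul_smul, norm_smul, mul_pow, Real.norm_eq_abs,
      sq_abs]
    congr 1
    field_simp

theorem inv_mul_cancel_left {x : Octonion} (hx : x ≠ 0) (y : Octonion) : x⁻¹ * (x * y) = y := by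
  have h : ‖x‖ ≠ 0 := norm_ne_zero_iff.2 hx
  rw [inv_def, Octonion.smul_mul, conj_mul_mul, smul_smul, inv_mul_cancel₀ (pow_ne_zero 2 h),
    one_smul]

theorem mul_inv_cancel_right {x : Octonion} (hx : x ≠ 0) (y : Octonion) : y * x * x⁻¹ = y := by
  have h : ‖x‖ ≠ 0 := norm_ne_zero_iff.2 hx
  rw [inv_def, Octonion.mul_smul, mul_mul_conj, smul_smul, inv_mul_cancel₀ (pow_ne_zero 2 h),
    one_smul]

theorem inv_mul_cancel_right {x : Octonion} (hx : x ≠ 0) (y : Octonion) : y * x⁻¹ * x = y := by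
  conv_lhs => rw [← Octonion.inv_inv hx, Octonion.inv_inv (Octonion.inv_ne_zero hx)]
  simpa only [Octonion.inv_inv hx] using mul_inv_cancel_right (Octonion.inv_ne_zero hx) y

protected theorem mul_inv_cancel {x : Octonion} (hx : x ≠ 0) : x * x⁻¹ = 1 := by
  simpa only [Octonion.one_mul] using mul_inv_cancel_right hx 1

/-- Left multiplication by `α / ‖α‖`. -/
def leftMulIsometry (α : Octonion) (hα : α ≠ 0) : Octonion ≃ₗᵢ[ℝ] Octonion :=
  LinearIsometry.toLinearIsometryEquiv
    { toFun := fun t => ‖α‖⁻¹ • (α * t)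
      map_add' := fun x y => by rw [Octonion.mul_add, smul_add]
      map_smul' := fun c x => by rw [Octonion.mul_smul, smul_comm, RingHom.id_apply]
      norm_map' := fun x => by
        have h : ‖α‖ ≠ 0 := norm_ne_zero_iff.2 hα
        change ‖‖α‖⁻¹ • (α * x)‖ = ‖x‖
        rw [norm_smul, Octonion.norm_mul, norm_inv, norm_norm, inv_mul_cancel_left₀ h] } rfl

theorem norm_smul_leftMulIsometry (α : Octonion) (hα : α ≠ 0) (t : Octonion) :
    ‖α‖ • leftMulIsometry α hα t = α * t := by
  change ‖α‖ • (‖α‖⁻¹ • (α * t)) = _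
  rw [smul_smul, mul_inv_cancel₀ (norm_ne_zero_iff.2 hα), one_smul]

/-- Right multiplication by `α / ‖α‖`. -/
def rightMulIsometry (α : Octonion) (hα : α ≠ 0) : Octonion ≃ₗᵢ[ℝ] Octonion :=
  LinearIsometry.toLinearIsometryEquiv
    { toFun := fun t => ‖α‖⁻¹ • (t * α)
      map_add' := fun x y => by rw [Octonion.add_mul, smul_add]
      map_smul' := fun c x => by rw [Octonion.smul_mul, smul_comm, RingHom.id_apply]
      norm_map' := fun x => by
        have h : ‖α‖ ≠ 0 := norm_ne_zero_iff.2 hα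
        change ‖‖α‖⁻¹ • (x * α)‖ = ‖x‖
        rw [norm_smul, Octonion.norm_mul, norm_inv, norm_norm, mul_comm ‖x‖,
          inv_mul_cancel_left₀ h] } rfl

theorem norm_smul_rightMulIsometry (α : Octonion) (hα : α ≠ 0) (t : Octonion) :
    ‖α‖ • rightMulIsometry α hα t = t * α := by
  change ‖α‖ • (‖α‖⁻¹ • (t * α)) = _
  rw [smul_smul, mul_inv_cancel₀ (norm_ne_zero_iff.2 hα), one_smul]

/-! ### The Cayley transform -/

theorem cayley_fst (x : OctonionPlane) :
    (cayley x).fst = √2 • (x.fst * (1 + x.snd)⁻¹) := rfl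

theorem cayley_snd {x : OctonionPlane} (hx : 1 + x.snd ≠ 0) :
    (cayley x).snd = (2 : ℝ) • (1 + x.snd)⁻¹ - 1 := by
  have h : 1 - x.snd = (2 : ℝ) • (1 : Octonion) - (1 + x.snd) := by
    rw [two_smul]; abel
  change (1 - x.snd) * (1 + x.snd)⁻¹ = _
  rw [h, Octonion.sub_mul, Octonion.mul_inv_cancel hx, Octonion.smul_mul, Octonion.one_mul]

/-- In the variable 1 + x₂ the second component of C is r ↦ 2 r⁻¹, an involution; this is why C is
its own inverse. -/
theorem one_add_cayley_snd {x : OctonionPlane} (hx : 1 + x.snd ≠ 0) :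
    1 + (cayley x).snd = (2 : ℝ) • (1 + x.snd)⁻¹ := by
  rw [cayley_snd hx, add_sub_cancel]

theorem one_add_cayley_snd_ne_zero {x : OctonionPlane} (hx : 1 + x.snd ≠ 0) :
    1 + (cayley x).snd ≠ 0 := by
  rw [one_add_cayley_snd hx]
  exact smul_ne_zero two_ne_zero (Octonion.inv_ne_zero hx)

theorem cayley_cayley {x : OctonionPlane} (hx : 1 + x.snd ≠ 0) : cayley (cayley x) = x := by
  have h : (1 + (cayley x).snd)⁻¹ = (2 : ℝ)⁻¹ • (1 + x.snd) := by
    rw [one_add_cayley_snd hx, Octonion.smul_inv, Octonion.inv_inv hx]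
  apply plane_ext
  · rw [cayley_fst, h, cayley_fst, Octonion.mul_smul, Octonion.smul_mul, inv_mul_cancel_right hx,
      smul_smul, smul_smul]
    have : √2 * 2⁻¹ * √2 = 1 := by
      rw [mul_right_comm, Real.mul_self_sqrt zero_le_two, mul_inv_cancel₀ two_ne_zero]
    rw [this, one_smul]
  · rw [cayley_snd (one_add_cayley_snd_ne_zero hx), h, smul_smul, mul_inv_cancel₀ two_ne_zero,
      one_smul, add_sub_cancel_left]

/-- The defining function `2 Re y₂ - |y₁|²` of the Siegel upper half space. -/
def siegelHeight (y : OctonionPlane) : ℝ := 2 * re y.snd - ‖y.fst‖ ^ 2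

/-- The Siegel upper half space. -/
def siegel : Set OctonionPlane := {y | 0 < siegelHeight y}

/-- The exact value, not merely its sign, is needed: the sign together with C ∘ C = id gives both
mapping properties between ball and half space, and the value fixes the dilation factor δ_a. -/
theorem siegelHeight_cayley {x : OctonionPlane} (hx : 1 + x.snd ≠ 0) :
    siegelHeight (cayley x) = 2 * (1 - ‖x‖ ^ 2) / ‖1 + x.snd‖ ^ 2 := by
  have h : ‖1 + x.snd‖ ≠ 0 := norm_ne_zero_iff.2 hx
  have hn := norm_one_add_sq x.snd
  rw [siegelHeight, cayley_snd hx, cayley_fst, norm_smul, Octonion.norm_mul, Octonion.norm_inv,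
    mul_pow, mul_pow, Real.norm_of_nonneg (Real.sqrt_nonneg 2), Real.sq_sqrt zero_le_two,
    plane_norm_sq, inv_def]
  simp only [re_sub, re_smul, re_conj, re_add, re_one]
  field_simp
  linear_combination (-1) * hn

theorem one_add_ne_zero_of_mem_unitBall {x : OctonionPlane} (hx : x ∈ unitBall) :
    1 + x.snd ≠ 0 := by
  intro h
  have h1 : ‖x‖ ^ 2 < 1 := by
    have : ‖x‖ < 1 := mem_ball_zero_iff.1 hx
    nlinarith [norm_nonneg x]
  rw [plane_norm_sq, ← neg_eq_of_add_eq_zero_right h, norm_neg, Octonion.norm_one] at h1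
  nlinarith [sq_nonneg ‖x.fst‖]

theorem one_add_ne_zero_of_mem_siegel {y : OctonionPlane} (hy : y ∈ siegel) : 1 + y.snd ≠ 0 := by
  intro h
  have h1 : 0 < 2 * re y.snd - ‖y.fst‖ ^ 2 := hy
  have h2 := congrArg re h
  simp only [re_add, re_one, re_zero] at h2
  nlinarith [sq_nonneg ‖y.fst‖]

theorem mapsTo_cayley_unitBall : MapsTo cayley unitBall siegel := by
  intro x hx
  have h := one_add_ne_zero_of_mem_unitBall hx
  have h1 : ‖x‖ < 1 := mem_ball_zero_iff.1 hx
  have h2 : 0 < ‖1 + x.snd‖ := norm_pos_iff.2 h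
  change 0 < siegelHeight (cayley x)
  rw [siegelHeight_cayley h]
  have : 0 < 1 - ‖x‖ ^ 2 := by nlinarith [norm_nonneg x]
  positivity

theorem mapsTo_cayley_siegel : MapsTo cayley siegel unitBall := by
  intro y hy
  have h := one_add_ne_zero_of_mem_siegel hy
  have h1 : 0 < siegelHeight y := hy
  rw [← cayley_cayley h, siegelHeight_cayley (one_add_cayley_snd_ne_zero h)] at h1
  have h2 : 0 < ‖1 + (cayley y).snd‖ ^ 2 :=
    pow_pos (norm_pos_iff.2 (one_add_cayley_snd_ne_zero h)) 2
  have h3 := (div_pos_iff_of_pos_right h2).1 h1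
  refine mem_ball_zero_iff.2 ?_
  nlinarith [norm_nonneg (cayley y)]

/-! ### Heisenberg translations and dilations -/

/-- The cross term 2⟪ζ₁, x₁⟫ of |x₁ + ζ₁|² equals 2 Re(ζ̄₁x₁), which is what the term ζ̄₁x₁ adds to
the height. -/
theorem siegelHeight_heisenbergTranslate {ζ : OctonionPlane} (hζ : siegelHeight ζ = 0)
    (x : OctonionPlane) : siegelHeight (heisenbergTranslate ζ x) = siegelHeight x := by
  have h : ‖x.fst + ζ.fst‖ ^ 2 = ‖x.fst‖ ^ 2 + 2 * re (conj ζ.fst * x.fst) + ‖ζ.fst‖ ^ 2 := by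
    rw [norm_add_sq_real, real_inner_comm, inner_eq_re]
  simp only [siegelHeight, heisenbergTranslate, pt_fst, pt_snd, re_add] at hζ ⊢
  linear_combination hζ - h

theorem siegelHeight_dilate (δ : ℝ) (x : OctonionPlane) :
    siegelHeight (dilate δ x) = δ ^ 2 * siegelHeight x := by
  simp only [siegelHeight, dilate, pt_fst, pt_snd, re_smul, norm_smul, mul_pow, Real.norm_eq_abs,
    sq_abs]
  ring

theorem mapsTo_heisenbergTranslate {ζ : OctonionPlane} (hζ : siegelHeight ζ = 0) :
    MapsTo (heisenbergTranslate ζ) siegel siegel := fun x hx => by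
  change 0 < siegelHeight _
  rwa [siegelHeight_heisenbergTranslate hζ]

theorem mapsTo_dilate {δ : ℝ} (hδ : δ ≠ 0) : MapsTo (dilate δ) siegel siegel := fun x hx => by
  have h : 0 < siegelHeight x := hx
  change 0 < siegelHeight _
  rw [siegelHeight_dilate]
  positivity

/-- The parameter of the inverse of a Heisenberg translation. -/
def heisenbergInv (ζ : OctonionPlane) : OctonionPlane :=
  pt (-ζ.fst) (-ζ.snd + ‖ζ.fst‖ ^ 2 • (1 : Octonion))

theorem siegelHeight_heisenbergInv {ζ : OctonionPlane} (hζ : siegelHeight ζ = 0) :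
    siegelHeight (heisenbergInv ζ) = 0 := by
  simp only [siegelHeight, heisenbergInv, pt_fst, pt_snd, re_add, re_neg, re_smul, re_one,
    norm_neg] at hζ ⊢
  linarith

theorem heisenbergTranslate_inv_left (ζ x : OctonionPlane) :
    heisenbergTranslate (heisenbergInv ζ) (heisenbergTranslate ζ x) = x := by
  apply plane_ext
  · simp [heisenbergTranslate, heisenbergInv]
  · simp only [heisenbergTranslate, heisenbergInv, pt_fst, pt_snd, conj_neg, Octonion.neg_mul,
      Octonion.mul_add, conj_mul_self]
    abel

theorem heisenbergTranslate_inv_right (ζ x : OctonionPlane) :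
    heisenbergTranslate ζ (heisenbergTranslate (heisenbergInv ζ) x) = x := by
  apply plane_ext
  · simp [heisenbergTranslate, heisenbergInv]
  · simp only [heisenbergTranslate, heisenbergInv, pt_fst, pt_snd, conj_neg, Octonion.neg_mul,
      Octonion.mul_add, Octonion.mul_neg, conj_mul_self]
    abel

theorem dilate_dilate_of_mul_eq_one {δ ε : ℝ} (h : δ * ε = 1) (x : OctonionPlane) :
    dilate δ (dilate ε x) = x := by
  apply plane_ext <;>
  simp only [dilate, pt_fst, pt_snd, smul_smul, ← mul_pow, h, one_pow, one_smul]

/-! ### Smoothness -/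

theorem contDiff_mul {n : WithTop ℕ∞} :
    ContDiff ℝ n fun p : Octonion × Octonion => p.1 * p.2 := by
  have : IsBoundedBilinearMap ℝ fun p : Octonion × Octonion => p.1 * p.2 :=
    { add_left := Octonion.add_mul
      smul_left := Octonion.smul_mul
      add_right := Octonion.mul_add
      smul_right := fun c x y => Octonion.mul_smul c x y
      bound := ⟨1, one_pos, fun x y => by rw [Octonion.norm_mul, _root_.one_mul]⟩ }
  exact this.contDiff

theorem contDiffAt_inv {n : WithTop ℕ∞} {x : Octonion} (hx : x ≠ 0) :
    ContDiffAt ℝ n (fun y : Octonion => y⁻¹) x := by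
  have h : ContDiffAt ℝ n (fun y : Octonion => (‖y‖ ^ 2)⁻¹) x :=
    (contDiff_norm_sq ℝ).contDiffAt.inv (by simpa using hx)
  exact h.smul conjIsometry.contDiff.contDiffAt

theorem contDiff_fst {n : WithTop ℕ∞} : ContDiff ℝ n fun x : OctonionPlane => x.fst :=
  _root_.contDiff_fst.comp (WithLp.prodContinuousLinearEquiv 2 ℝ Octonion Octonion).contDiff

theorem contDiff_snd {n : WithTop ℕ∞} : ContDiff ℝ n fun x : OctonionPlane => x.snd :=
  _root_.contDiff_snd.comp (WithLp.prodContinuousLinearEquiv 2 ℝ Octonion Octonion).contDiff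

theorem contDiffAt_pt {n : WithTop ℕ∞} {f g : OctonionPlane → Octonion} {x : OctonionPlane}
    (hf : ContDiffAt ℝ n f x) (hg : ContDiffAt ℝ n g x) :
    ContDiffAt ℝ n (fun y => pt (f y) (g y)) x := by
  have h : ContDiffAt ℝ n (fun y => (f y, g y)) x := hf.prodMk hg
  exact (WithLp.prodContinuousLinearEquiv 2 ℝ Octonion
    Octonion).symm.contDiff.contDiffAt.comp x h

theorem contDiffAt_mul {n : WithTop ℕ∞} {f g : OctonionPlane → Octonion} {x : OctonionPlane}
    (hf : ContDiffAt ℝ n f x) (hg : ContDiffAt ℝ n g x) :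
    ContDiffAt ℝ n (fun y => f y * g y) x := by
  have h : ContDiffAt ℝ n (fun y => (f y, g y)) x := hf.prodMk hg
  exact contDiff_mul.contDiffAt.comp x h

theorem contDiffAt_cayley {n : WithTop ℕ∞} {x : OctonionPlane} (hx : 1 + x.snd ≠ 0) :
    ContDiffAt ℝ n cayley x := by
  have hinv : ContDiffAt ℝ n (fun y : OctonionPlane => (1 + y.snd)⁻¹) x :=
    (contDiffAt_inv hx).comp x (contDiff_const.add contDiff_snd).contDiffAt
  exact contDiffAt_pt ((contDiffAt_mul contDiff_fst.contDiffAt hinv).const_smul _)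
    (contDiffAt_mul (contDiff_const.sub contDiff_snd).contDiffAt hinv)

theorem contDiff_heisenbergTranslate {n : WithTop ℕ∞} (ζ : OctonionPlane) :
    ContDiff ℝ n (heisenbergTranslate ζ) := by
  refine contDiff_iff_contDiffAt.2 fun x => ?_
  have hf : ContDiffAt ℝ n (fun y : OctonionPlane => y.fst) x := contDiff_fst.contDiffAt
  have hs : ContDiffAt ℝ n (fun y : OctonionPlane => y.snd) x := contDiff_snd.contDiffAt
  have hm : ContDiffAt ℝ n (fun y : OctonionPlane => conj ζ.fst * y.fst) x :=
    contDiffAt_mul contDiffAt_const hf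
  exact contDiffAt_pt (hf.add contDiffAt_const) ((hs.add contDiffAt_const).add hm)

theorem contDiff_dilate {n : WithTop ℕ∞} (δ : ℝ) : ContDiff ℝ n (dilate δ) :=
  contDiff_iff_contDiffAt.2 fun _ => contDiffAt_pt (contDiff_fst.const_smul δ).contDiffAt
    (contDiff_snd.const_smul (δ ^ 2)).contDiffAt

end Octonion

/-! ### Invariance of plurisubharmonicity under the building blocks of T_a. -/

namespace Octonion

open Set

theorem OPSH.congr {Ω : Set OctonionPlane} {u v : OctonionPlane → EReal} (hu : OPSH Ω u)
    (huv : EqOn u v Ω) : OPSH Ω v :=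
  ⟨hu.1.congr_eqOn huv, fun x hx => huv hx ▸ hu.2.1 x hx, fun p =>
    ⟨fun α => ((hu.2.2 p).1 α).congr fun _ ht => huv ht, (hu.2.2 p).2.congr fun _ ht => huv ht⟩⟩

theorem SubharmonicOn.of_isEmpty {E : Type*} [NormedAddCommGroup E] [InnerProductSpace ℝ E]
    [FiniteDimensional ℝ E] {f : E → EReal} {Ω : Set E} (hΩ : ∀ x, x ∉ Ω) : SubharmonicOn f Ω :=
  ⟨fun x hx => absurd hx (hΩ x), fun x hx => absurd hx (hΩ x),
    fun _ _ _ _ hsub _ _ x hx => absurd (hsub (subset_closure hx)) (hΩ x)⟩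

/-- Subharmonicity along a right line parametrized by `s ↦ q + (κ s, c s)`. -/
theorem OPSH.subharmonicOn_line {Ω : Set OctonionPlane} {u : OctonionPlane → EReal}
    (hu : OPSH Ω u) (q : OctonionPlane) (κ : Octonion) {c : ℝ} (hc : c ≠ 0) :
    SubharmonicOn (fun s => u (q + pt (κ * s) (c • s))) {s | q + pt (κ * s) (c • s) ∈ Ω} := by
  rcases eq_or_ne κ 0 with rfl | hκ
  · refine ((hu.2.2 q).2.comp_similarity (Ω := {s | q + pt (0 * s) (c • s) ∈ Ω})
      (LinearIsometryEquiv.refl ℝ Octonion) hc one_pos 0 ?_).congr ?_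
    · intro s hs
      simpa [Octonion.zero_mul] using hs
    · intro s _
      simp [Octonion.zero_mul]
  -- The substitution t = κs turns the line into the standard one of slope α = cκ⁻¹, because κ⁻¹(κs)
  -- = s.
  · have key : ∀ s, pt (κ * s) (c • s) =
        pt (‖κ‖ • leftMulIsometry κ hκ s + 0)
          ((c • κ⁻¹) * (‖κ‖ • leftMulIsometry κ hκ s + 0)) := fun s => by
      rw [add_zero, norm_smul_leftMulIsometry, Octonion.smul_mul, inv_mul_cancel_left hκ]
    refine (((hu.2.2 q).1 (c • κ⁻¹)).comp_similarity (Ω := {s | q + pt (κ * s) (c • s) ∈ Ω})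
      (leftMulIsometry κ hκ) (norm_ne_zero_iff.2 hκ) one_pos 0 ?_).congr ?_
    · intro s hs
      change q + pt _ _ ∈ Ω
      rw [← key]
      exact hs
    · intro s _
      change (((1 : ℝ) : EReal)) * u (q + pt _ _) = u (q + pt _ _)
      rw [← key, EReal.coe_one, one_mul]

/-- Octonionic inversion r⁻¹ = r̄ / |r|² is the geometric inversion followed by the isometry of
conjugation, so the Kelvin weight |r|⁻⁶ applies. -/
theorem OPSH.subharmonicOn_inverted_line {Ω : Set OctonionPlane} {u : OctonionPlane → EReal}
    (hu : OPSH Ω u) (q : OctonionPlane) (κ : Octonion) {c : ℝ} (hc : c ≠ 0) :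
    SubharmonicOn (fun r => (((‖r‖ ^ 6)⁻¹ : ℝ) : EReal) * u (q + pt (κ * r⁻¹) (c • r⁻¹)))
      {r | r ≠ 0 ∧ q + pt (κ * r⁻¹) (c • r⁻¹) ∈ Ω} :=
  (hu.subharmonicOn_line q κ hc).comp_inversion finrank_eq_eight conjIsometry conj_conj
    (fun _ hr => hr.1) fun _ hr => hr.2

/-- On each line, either 1 + x₂ is constant and C acts as a similarity, or r = 1 + x₂ can be taken
as the parameter and C acts through r⁻¹; the weight is exactly the Kelvin factor |r|⁻⁶. -/
theorem OPSH.cayley {Ω Ω' : Set OctonionPlane} {u : OctonionPlane → EReal} (hu : OPSH Ω u)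
    (h0 : ∀ x ∈ Ω', 1 + x.snd ≠ 0) (hmaps : MapsTo cayley Ω' Ω) :
    OPSH Ω' fun x => (((‖1 + x.snd‖ ^ 6)⁻¹ : ℝ) : EReal) * u (cayley x) := by
  have hpos : ∀ x ∈ Ω', 0 < (‖1 + x.snd‖ ^ 6)⁻¹ := fun x hx =>
    inv_pos.2 (pow_pos (norm_pos_iff.2 (h0 x hx)) 6)
  have hC : ContinuousOn Octonion.cayley Ω' := fun x hx =>
    (contDiffAt_cayley (n := 0) (h0 x hx)).continuousAt.continuousWithinAt
  have hw : ContinuousOn (fun x : OctonionPlane => (‖1 + x.snd‖ ^ 6)⁻¹) Ω' := by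
    have h : Continuous fun x : OctonionPlane => ‖1 + x.snd‖ ^ 6 :=
      (continuous_const.add (contDiff_snd (n := 0)).continuous).norm.pow 6
    exact h.continuousOn.inv₀ fun x hx => (inv_pos.1 (hpos x hx)).ne'
  refine ⟨(hu.1.comp hC hmaps).coe_mul (fun x hx => hu.2.1 _ (hmaps hx)) hw hpos,
    fun x hx => EReal.coe_mul_lt_top (hpos x hx) (hu.2.1 _ (hmaps hx)), fun p => ⟨fun α => ?_, ?_⟩⟩
  · set Λ : Set Octonion := {t | p + pt t (α * t) ∈ Ω'}
    -- For α = 0 the weight is constant along the line and no inversion occurs. If moreover 1 + p₂ =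
    -- 0, the line misses Ω'.
    rcases eq_or_ne α 0 with rfl | hα
    · have hsnd : ∀ t, (p + pt t (0 * t)).snd = p.snd := fun t => by
        simp [Octonion.zero_mul]
      by_cases hp : 1 + p.snd = 0
      · exact SubharmonicOn.of_isEmpty fun t ht => h0 _ ht (by rw [hsnd, hp])
      · have hs0 := Octonion.inv_ne_zero hp
        have hc : √2 * ‖(1 + p.snd)⁻¹‖ ≠ 0 := by
          have := norm_ne_zero_iff.2 hs0
          positivity
        have key : ∀ t, Octonion.cayley (p + pt t (0 * t)) = Octonion.cayley p +
            pt ((√2 * ‖(1 + p.snd)⁻¹‖) • rightMulIsometry _ hs0 t + 0)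
              (0 * ((√2 * ‖(1 + p.snd)⁻¹‖) • rightMulIsometry _ hs0 t + 0)) := fun t => by
          rw [add_zero, mul_smul, norm_smul_rightMulIsometry]
          apply plane_ext
          · rw [cayley_fst, hsnd, WithLp.add_fst, WithLp.add_fst, cayley_fst, Octonion.add_mul,
              smul_add]
            rfl
          · rw [cayley_snd (by rwa [hsnd]), hsnd, WithLp.add_snd, cayley_snd hp, pt_snd,
              Octonion.zero_mul, add_zero]
        refine (((hu.2.2 (Octonion.cayley p)).1 0).comp_similarity (Ω := Λ)
          (rightMulIsometry _ hs0) hc (inv_pos.2 (pow_pos (norm_pos_iff.2 hp) 6)) 0 ?_).congr ?_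
        · intro t ht
          have := hmaps ht
          rwa [key] at this
        · intro t _
          simp only [key, hsnd]
    -- From r = 1 + p₂ + αt one gets x₁ = p₁ + t = (p₁ - α⁻¹(1 + p₂)) + α⁻¹r. Multiplying by r⁻¹ on
    -- the right gives α⁻¹ plus a constant times r⁻¹, by (α⁻¹r)r⁻¹ = α⁻¹.
    · have key : ∀ t ∈ Λ, 1 + (p + pt t (α * t)).snd ≠ 0 →
          Octonion.cayley (p + pt t (α * t)) = pt (√2 • α⁻¹) (-1) +
            pt ((√2 • (p.fst - α⁻¹ * (1 + p.snd))) * (1 + (p + pt t (α * t)).snd)⁻¹)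
              ((2 : ℝ) • (1 + (p + pt t (α * t)).snd)⁻¹) := fun t _ hr => by
        apply plane_ext
        · have h1 : (p + pt t (α * t)).fst = p.fst - α⁻¹ * (1 + p.snd) +
              α⁻¹ * (1 + (p + pt t (α * t)).snd) := by
            simp only [WithLp.add_fst, WithLp.add_snd, pt_fst, pt_snd, Octonion.mul_add,
              inv_mul_cancel_left hα]
            abel
          rw [cayley_fst, h1, Octonion.add_mul, mul_inv_cancel_right hr, WithLp.add_fst, pt_fst,
            pt_fst, Octonion.smul_mul, smul_add, add_comm]
        · rw [cayley_snd hr]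
          exact sub_eq_neg_add _ _
      have hr : ∀ t, 1 + (p + pt t (α * t)).snd =
          ‖α‖ • leftMulIsometry α hα t + (1 + p.snd) := fun t => by
        rw [norm_smul_leftMulIsometry, WithLp.add_snd, pt_snd, ← add_assoc, add_comm]
      refine ((hu.subharmonicOn_inverted_line (pt (√2 • α⁻¹) (-1))
        (√2 • (p.fst - α⁻¹ * (1 + p.snd))) two_ne_zero).comp_similarity (Ω := Λ)
        (leftMulIsometry α hα) (norm_ne_zero_iff.2 hα) one_pos (1 + p.snd) ?_).congr ?_
      · intro t ht
        have h1 := hmaps ht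
        have h2 := h0 _ ht
        rw [key t ht h2] at h1
        simp only [← hr]
        exact ⟨h2, h1⟩
      · intro t ht
        simp only [← hr, EReal.coe_one, one_mul, key t ht (h0 _ ht)]
  · set Λ : Set Octonion := {t | p + pt 0 t ∈ Ω'}
    have key : ∀ t, 1 + (p + pt 0 t).snd ≠ 0 →
        Octonion.cayley (p + pt 0 t) = pt 0 (-1) +
          pt ((√2 • p.fst) * (1 + (p + pt 0 t).snd)⁻¹)
            ((2 : ℝ) • (1 + (p + pt 0 t).snd)⁻¹) := fun t hr => by
      apply plane_ext
      · rw [cayley_fst, WithLp.add_fst, pt_fst, WithLp.add_fst, pt_fst, pt_fst, zero_add, add_zero,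
          Octonion.smul_mul]
      · rw [cayley_snd hr]
        exact sub_eq_neg_add _ _
    have hr : ∀ t, 1 + (p + pt 0 t).snd =
        (1 : ℝ) • LinearIsometryEquiv.refl ℝ Octonion t + (1 + p.snd) := fun t => by
      rw [one_smul, WithLp.add_snd, pt_snd, ← add_assoc, add_comm]
      rfl
    refine ((hu.subharmonicOn_inverted_line (pt 0 (-1)) (√2 • p.fst)
      two_ne_zero).comp_similarity (Ω := Λ) (LinearIsometryEquiv.refl ℝ Octonion) one_ne_zero
      one_pos (1 + p.snd) ?_).congr ?_
    · intro t ht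
      have h1 := hmaps ht
      have h2 := h0 _ ht
      rw [key t h2] at h1
      simp only [← hr]
      exact ⟨h2, h1⟩
    · intro t ht
      simp only [← hr, EReal.coe_one, one_mul, key t (h0 _ ht)]

/-- Lines of slope α go to lines of slope δ(α + ζ̄₁), with parameter scaled by δ; vertical lines
stay vertical, with parameter scaled by δ². Distributivity suffices because ζ̄₁ multiplies t on the
left, as α does. -/
theorem OPSH.dilate_heisenbergTranslate {Ω Ω' : Set OctonionPlane} {u : OctonionPlane → EReal}
    (hu : OPSH Ω u) {δ : ℝ} (hδ : δ ≠ 0) (ζ : OctonionPlane)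
    (hmaps : MapsTo (fun x => dilate δ (heisenbergTranslate ζ x)) Ω' Ω) :
    OPSH Ω' fun x => u (dilate δ (heisenbergTranslate ζ x)) := by
  have hC : Continuous fun x => dilate δ (heisenbergTranslate ζ x) :=
    (contDiff_dilate (n := 0) δ).continuous.comp (contDiff_heisenbergTranslate (n := 0) ζ).continuous
  refine ⟨hu.1.comp hC.continuousOn hmaps, fun x hx => hu.2.1 _ (hmaps hx), fun p =>
    ⟨fun α => ?_, ?_⟩⟩
  · set q := dilate δ (heisenbergTranslate ζ p)
    have key : ∀ t, dilate δ (heisenbergTranslate ζ (p + pt t (α * t))) = q +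
        pt (δ • LinearIsometryEquiv.refl ℝ Octonion t + 0)
          ((δ • (α + conj ζ.fst)) * (δ • LinearIsometryEquiv.refl ℝ Octonion t + 0)) := fun t => by
      rw [add_zero]
      change _ = _ + pt (δ • t) ((δ • (α + conj ζ.fst)) * (δ • t))
      apply plane_ext <;>
      simp only [q, dilate, heisenbergTranslate, pt_fst, pt_snd, WithLp.add_fst, WithLp.add_snd,
        Octonion.mul_add, Octonion.add_mul, Octonion.smul_mul, Octonion.mul_smul, smul_add,
        smul_smul, ← sq] <;> abel
    refine (((hu.2.2 q).1 (δ • (α + conj ζ.fst))).comp_similarity (Ω := {t | p + pt t (α * t) ∈ Ω'})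
      (LinearIsometryEquiv.refl ℝ Octonion) hδ one_pos 0 ?_).congr ?_
    · intro t ht
      have := hmaps ht
      simp only [key] at this
      exact this
    · intro t _
      simp only [key, EReal.coe_one, one_mul]
  · set q := dilate δ (heisenbergTranslate ζ p)
    have key : ∀ t, dilate δ (heisenbergTranslate ζ (p + pt 0 t)) = q +
        pt 0 (δ ^ 2 • LinearIsometryEquiv.refl ℝ Octonion t + 0) := fun t => by
      rw [add_zero]
      change _ = _ + pt 0 (δ ^ 2 • t)
      apply plane_ext <;>
      simp only [q, dilate, heisenbergTranslate, pt_fst, pt_snd, WithLp.add_fst, WithLp.add_snd,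
        add_zero, smul_add]
      abel
    refine ((hu.2.2 q).2.comp_similarity (Ω := {t | p + pt 0 t ∈ Ω'})
      (LinearIsometryEquiv.refl ℝ Octonion) (pow_ne_zero 2 hδ) one_pos 0 ?_).congr ?_
    · intro t ht
      have := hmaps ht
      simp only [key] at this
      exact this
    · intro t _
      simp only [key, EReal.coe_one, one_mul]

/-! ### The automorphism T_a and its weight. -/

theorem siegelHeight_zeta (a : OctonionPlane) : siegelHeight (zeta a) = 0 := by
  simp [siegelHeight, zeta, im]

theorem one_sub_norm_sq_pos {a : OctonionPlane} (ha : a ∈ unitBall) : 0 < 1 - ‖a‖ ^ 2 := by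
  have : ‖a‖ < 1 := mem_ball_zero_iff.1 ha
  nlinarith [norm_nonneg a]

theorem delta_pos {a : OctonionPlane} (ha : a ∈ unitBall) : 0 < delta a :=
  div_pos (norm_pos_iff.2 (one_add_ne_zero_of_mem_unitBall ha))
    (Real.sqrt_pos.2 (one_sub_norm_sq_pos ha))

theorem ballAut_self {a : OctonionPlane} (ha : a ∈ unitBall) : ballAut a a = 0 := by
  have h0 := one_add_ne_zero_of_mem_unitBall ha
  have hn : ‖1 + a.snd‖ ≠ 0 := norm_ne_zero_iff.2 h0
  have hpos := one_sub_norm_sq_pos ha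
  have hH := siegelHeight_cayley h0
  -- The choice of ζ_a kills the first component and the imaginary part of the second, leaving a
  -- real point that the dilation by δ_a normalizes to (0, 1), which C sends to 0.
  have hτ : heisenbergTranslate (zeta a) (cayley a) =
      pt 0 ((siegelHeight (cayley a) / 2) • (1 : Octonion)) := by
    apply plane_ext
    · simp [heisenbergTranslate, zeta]
    · simp only [heisenbergTranslate, zeta, pt_fst, pt_snd, conj_neg, Octonion.neg_mul,
        conj_mul_self, im, siegelHeight]
      module
  have hD : dilate (delta a) (heisenbergTranslate (zeta a) (cayley a)) = pt 0 1 := by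
    have hδ : delta a ^ 2 * (siegelHeight (cayley a) / 2) = 1 := by
      rw [hH, delta, div_pow, Real.sq_sqrt hpos.le]
      field_simp
    rw [hτ, dilate, pt_fst, pt_snd, smul_zero, smul_smul, hδ, one_smul]
  rw [ballAut, hD]
  apply plane_ext
  · simp [cayleyInv, Octonion.zero_mul]
  · simp [cayleyInv, Octonion.zero_mul]

/-- The automorphism of the Siegel upper half space conjugate to `ballAut a`. -/
def siegelAut (a x : OctonionPlane) : OctonionPlane :=
  dilate (delta a) (heisenbergTranslate (zeta a) x)

/-- The inverse of `siegelAut a`. -/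
def siegelAutInv (a x : OctonionPlane) : OctonionPlane :=
  heisenbergTranslate (heisenbergInv (zeta a)) (dilate (delta a)⁻¹ x)

theorem ballAut_eq (a : OctonionPlane) : ballAut a = fun x => cayley (siegelAut a (cayley x)) := rfl

theorem mapsTo_siegelAut {a : OctonionPlane} (ha : a ∈ unitBall) :
    MapsTo (siegelAut a) siegel siegel := fun _ hx =>
  mapsTo_dilate (delta_pos ha).ne'
    (mapsTo_heisenbergTranslate (siegelHeight_zeta a) hx)

theorem mapsTo_siegelAutInv {a : OctonionPlane} (ha : a ∈ unitBall) :
    MapsTo (siegelAutInv a) siegel siegel := fun _ hx =>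
  mapsTo_heisenbergTranslate (siegelHeight_heisenbergInv (siegelHeight_zeta a))
    (mapsTo_dilate (inv_ne_zero (delta_pos ha).ne') hx)

theorem contDiff_siegelAut {n : WithTop ℕ∞} (a : OctonionPlane) : ContDiff ℝ n (siegelAut a) :=
  ContDiff.comp (g := dilate (delta a)) (contDiff_dilate _) (contDiff_heisenbergTranslate _)

theorem contDiff_siegelAutInv {n : WithTop ℕ∞} (a : OctonionPlane) :
    ContDiff ℝ n (siegelAutInv a) :=
  ContDiff.comp (g := heisenbergTranslate (heisenbergInv (zeta a)))
    (contDiff_heisenbergTranslate _) (contDiff_dilate _)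

theorem siegelAutInv_siegelAut {a : OctonionPlane} (ha : a ∈ unitBall) (x : OctonionPlane) :
    siegelAutInv a (siegelAut a x) = x := by
  rw [siegelAutInv, siegelAut, dilate_dilate_of_mul_eq_one (inv_mul_cancel₀ (delta_pos ha).ne'),
    heisenbergTranslate_inv_left]

theorem siegelAut_siegelAutInv {a : OctonionPlane} (ha : a ∈ unitBall) (x : OctonionPlane) :
    siegelAut a (siegelAutInv a x) = x := by
  rw [siegelAutInv, siegelAut, heisenbergTranslate_inv_right,
    dilate_dilate_of_mul_eq_one (mul_inv_cancel₀ (delta_pos ha).ne')]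

theorem contDiffOn_cayley_conj {n : WithTop ℕ∞} {φ : OctonionPlane → OctonionPlane}
    (hφ : ContDiff ℝ n φ) (hmaps : MapsTo φ siegel siegel) :
    ContDiffOn ℝ n (fun x => cayley (φ (cayley x))) unitBall := by
  intro x hx
  have h1 : ContDiffAt ℝ n cayley x := contDiffAt_cayley (one_add_ne_zero_of_mem_unitBall hx)
  have h2 : ContDiffAt ℝ n cayley (φ (cayley x)) :=
    contDiffAt_cayley (one_add_ne_zero_of_mem_siegel (hmaps (mapsTo_cayley_unitBall hx)))
  have h3 : ContDiffAt ℝ n (fun y => φ (cayley y)) x := ContDiffAt.comp x hφ.contDiffAt h1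
  exact (ContDiffAt.comp x h2 h3).contDiffWithinAt

theorem leftInvOn_cayley_conj {φ ψ : OctonionPlane → OctonionPlane}
    (hφ : MapsTo φ siegel siegel) (h : ∀ x, ψ (φ x) = x) :
    LeftInvOn (fun x => cayley (ψ (cayley x))) (fun x => cayley (φ (cayley x))) unitBall := by
  intro x hx
  have h1 := one_add_ne_zero_of_mem_siegel (hφ (mapsTo_cayley_unitBall hx))
  simp only [cayley_cayley h1, h, cayley_cayley (one_add_ne_zero_of_mem_unitBall hx)]

/-- With y the image of C(x) under `siegelAut a`, 1 + [T_a(x)]₂ = 2(1 + y₂)⁻¹, so the factor 2 in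
Ψ_a cancels and Ψ_a(x) = (1 + y₂)(1 + x₂). Its norm is the product of the two Cayley weights' bases.
-/
theorem norm_psi {a x : OctonionPlane} (ha : a ∈ unitBall) (hx : x ∈ unitBall) :
    ‖psi a x‖ =
      ‖1 + (siegelAut a (cayley x)).snd‖ * ‖1 + x.snd‖ := by
  have h1 := one_add_ne_zero_of_mem_siegel
    (mapsTo_siegelAut ha (mapsTo_cayley_unitBall hx))
  have h2 : 1 + (ballAut a x).snd = (2 : ℝ) • (1 + (siegelAut a (cayley x)).snd)⁻¹ :=
    one_add_cayley_snd h1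
  rw [psi, h2, Octonion.smul_inv, Octonion.inv_inv h1, norm_smul, Octonion.norm_mul, norm_smul,
    Real.norm_ofNat, norm_inv, Real.norm_ofNat]
  ring

theorem OPSH.weightedPullback {a : OctonionPlane} (ha : a ∈ unitBall) {u : OctonionPlane → EReal}
    (hu : OPSH unitBall u) : OPSH unitBall (weightedPullback a u) := by
  -- The pullbacks are taken from the outermost map inwards: first to the half space, then along the
  -- affine automorphism, then back to the ball.
  have h1 := hu.cayley (fun _ => one_add_ne_zero_of_mem_siegel) mapsTo_cayley_siegel
  have h2 := h1.dilate_heisenbergTranslate (delta_pos ha).ne' (zeta a)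
    (mapsTo_siegelAut ha)
  have h3 := h2.cayley (fun _ => one_add_ne_zero_of_mem_unitBall) mapsTo_cayley_unitBall
  refine h3.congr fun x hx => ?_
  have hψ := norm_psi ha hx
  change _ = ((1 / ‖psi a x‖ ^ 6 : ℝ) : EReal) *
    u (Octonion.cayley (siegelAut a (Octonion.cayley x)))
  change ((‖1 + x.snd‖ ^ 6)⁻¹ : ℝ) * (((‖1 + (siegelAut a (Octonion.cayley x)).snd‖ ^ 6)⁻¹ : ℝ) *
    u (Octonion.cayley (siegelAut a (Octonion.cayley x)))) = _
  rw [hψ, mul_comm ‖_‖ ‖1 + x.snd‖, mul_pow, one_div, mul_inv, EReal.coe_mul, mul_assoc]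

theorem mapsTo_cayley_conj {φ : OctonionPlane → OctonionPlane} (hφ : MapsTo φ siegel siegel) :
    MapsTo (fun x => cayley (φ (cayley x))) unitBall unitBall :=
  fun _ hx => mapsTo_cayley_siegel (hφ (mapsTo_cayley_unitBall hx))

theorem psi_ne_zero {a x : OctonionPlane} (ha : a ∈ unitBall) (hx : x ∈ unitBall) :
    psi a x ≠ 0 := by
  rw [← norm_ne_zero_iff, norm_psi ha hx]
  exact mul_ne_zero (norm_ne_zero_iff.2 (one_add_ne_zero_of_mem_siegel
    (mapsTo_siegelAut ha (mapsTo_cayley_unitBall hx))))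
    (norm_ne_zero_iff.2 (one_add_ne_zero_of_mem_unitBall hx))

end Octonion

end

theorem proposition6p2 (a : OctonionPlane) (ha : a ∈ Octonion.unitBall) :
    (Octonion.ballAut a a = 0 ∧
      Set.MapsTo (Octonion.ballAut a) Octonion.unitBall Octonion.unitBall ∧
      ContDiffOn ℝ ∞ (Octonion.ballAut a) Octonion.unitBall ∧
      ∃ S : OctonionPlane → OctonionPlane,
        Set.MapsTo S Octonion.unitBall Octonion.unitBall ∧
        Set.InvOn S (Octonion.ballAut a) Octonion.unitBall Octonion.unitBall ∧
        ContDiffOn ℝ ∞ S Octonion.unitBall) ∧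
    (∀ x ∈ Octonion.unitBall, Octonion.psi a x ≠ 0) ∧
    ∀ u : OctonionPlane → EReal, Octonion.OPSH Octonion.unitBall u →
      Octonion.OPSH Octonion.unitBall (Octonion.weightedPullback a u) := by
  refine ⟨⟨Octonion.ballAut_self ha, ?_⟩, fun _ hx => Octonion.psi_ne_zero ha hx,
    fun _ hu => hu.weightedPullback ha⟩
  rw [Octonion.ballAut_eq]
  exact ⟨Octonion.mapsTo_cayley_conj (Octonion.mapsTo_siegelAut ha),
    Octonion.contDiffOn_cayley_conj (Octonion.contDiff_siegelAut a) (Octonion.mapsTo_siegelAut ha),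
    fun x => Octonion.cayley (Octonion.siegelAutInv a (Octonion.cayley x)),
    Octonion.mapsTo_cayley_conj (Octonion.mapsTo_siegelAutInv ha),
    ⟨Octonion.leftInvOn_cayley_conj (Octonion.mapsTo_siegelAut ha)
      (Octonion.siegelAutInv_siegelAut ha),
    Octonion.leftInvOn_cayley_conj (Octonion.mapsTo_siegelAutInv ha)
      (Octonion.siegelAut_siegelAutInv ha)⟩,
    Octonion.contDiffOn_cayley_conj (Octonion.contDiff_siegelAutInv a)
      (Octonion.mapsTo_siegelAutInv ha)⟩
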